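/- Let $n, m$ be integers with $n \ge 3$ and $0 \le m \le n-1$. For $k \ge 1$ let $\mathcal{K}_k^n$ be the family of the $k^n$ cubes $\prod_{s=1}^n \left[\frac{i_s-1}{k}, \frac{i_s}{k}\right]$, $i_s \in \{1,\dots,k\}$, into which the unit cube $I^n = [0,1]^n$ is divided. A set $S \subseteq I^n$ *connects some opposite faces of $I^n$* if $S$ is connected and, for some $i \in \{1,\dots,n\}$, it meets both $\{z \in I^n : z_i = 0\}$ and $\{z \in I^n : z_i = 1\}$. A set $P \subseteq \mathbb{Z}^{n-1}$ is *$1$-connected* if any two of its points are joined by a finite sequence of points of $P$ whose consecutive terms are at $\ell^\infty$-distance at most $1$. Write $\dim$ for topological dimension (so that the empty set does not have dimension $\ge 0$). Call a function $F \colon \mathcal{K}_k^n \to \mathbb{Z}^{n-1}$ *$m$-admissible* if $\|F(K_1) - F(K_2)\|_\infty \le 1$ for all $K_1, K_2 \in \mathcal{K}_k^n$ with $\dim(K_1 \cap K_2) \ge m$. Let $\widehat{C}_{n,m}$ be the minimum of the real constants $C > 0$ with the following property: for every $k \ge 1$ and every $m$-admissible $F \colon \mathcal{K}_k^n \to \mathbb{Z}^{n-1}$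 there exist a $1$-connected set $P \subseteq \mathbb{Z}^{n-1}$ with $|P| \le C$ and a subfamily $\mathcal{S} \subseteq F^{-1}[P]$ such that $\bigcup \mathcal{S}$ connects some opposite faces of $I^n$. Then this minimum exists and $\widehat{C}_{n,m} > 1$. In other words, a single level value does not suffice: there are $k \ge 1$ and an $m$-admissible $F \colon \mathcal{K}_k^n \to \mathbb{Z}^{n-1}$ such that for no $p \in \mathbb{Z}^{n-1}$ and no $\mathcal{S} \subseteq F^{-1}[\{p\}]$ does $\bigcup \mathcal{S}$ connect some opposite faces of $I^n$. -/

import Mathlib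

namespace Chessboard

/-- The unit cube `Iⁿ = [0, 1]ⁿ`. -/
def unitCube (n : ℕ) : Set (Fin n → ℝ) :=
  Set.univ.pi fun _ => Set.Icc (0 : ℝ) 1

/-- The box `∏ₛ [(iₛ - 1)/k, iₛ/k]`. -/
def box (n k : ℕ) (i : Fin n → ℕ) : Set (Fin n → ℝ) :=
  Set.univ.pi fun s => Set.Icc (((i s : ℝ) - 1) / (k : ℝ)) ((i s : ℝ) / (k : ℝ))

/-- The family of the `kⁿ` cubes with side length `1/k` into which `Iⁿ` is divided. -/
def cubes (n k : ℕ) : Set (Set (Fin n → ℝ)) :=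
  {K | ∃ i : Fin n → ℕ, (∀ s, 1 ≤ i s ∧ i s ≤ k) ∧ K = box n k i}

/-- The face `{z ∈ Iⁿ : zᵢ = 0}`. -/
def lowerFace (n : ℕ) (i : Fin n) : Set (Fin n → ℝ) :=
  {z | z ∈ unitCube n ∧ z i = 0}

/-- The face `{z ∈ Iⁿ : zᵢ = 1}`. -/
def upperFace (n : ℕ) (i : Fin n) : Set (Fin n → ℝ) :=
  {z | z ∈ unitCube n ∧ z i = 1}

/-- `S ⊆ Iⁿ` connects the `i`-th opposite faces of `Iⁿ`. -/
def ConnectsFaces {n : ℕ} (S : Set (Fin n → ℝ)) (i : Fin n) : Prop :=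
  S ⊆ unitCube n ∧ IsConnected S ∧
    (S ∩ lowerFace n i).Nonempty ∧ (S ∩ upperFace n i).Nonempty

/-- `S ⊆ Iⁿ` connects some opposite faces of `Iⁿ`. -/
def ConnectsSomeFaces {n : ℕ} (S : Set (Fin n → ℝ)) : Prop :=
  ∃ i : Fin n, ConnectsFaces S i

/-- A subset `S` of a metric space is `r`-connected if any two of its points are joined by a
finite sequence in `S` whose consecutive terms are at distance at most `r`. -/
def IsRConnected {X : Type*} [MetricSpace X] (r : ℝ) (S : Set X) : Prop :=
  ∀ x ∈ S, ∀ y ∈ S, ∃ (N : ℕ) (p : Fin (N + 1) → X),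
    (∀ j, p j ∈ S) ∧ (∀ j : Fin N, dist (p j.castSucc) (p j.succ) ≤ r) ∧
      p 0 = x ∧ p (Fin.last N) = y

/-- The topological dimension of a subset of `ℝⁿ`. All the standard notions (small inductive,
large inductive, covering dimension) agree on subsets of `ℝⁿ`; the empty set has dimension `⊥`. -/
noncomputable def topDim {n : ℕ} (A : Set (Fin n → ℝ)) : WithBot ℕ∞ :=
  smallInductiveDimension A

/-- `‖F(K₁) - F(K₂)‖_∞ ≤ 1` whenever `dim (K₁ ∩ K₂) ≥ m`. The norm on `Fin (n - 1) → ℤ` is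
the supremum norm. -/
def IsAdmissible {n k : ℕ} (m : ℕ) (F : cubes n k → (Fin (n - 1) → ℤ)) : Prop :=
  ∀ K₁ K₂ : cubes n k,
    (m : WithBot ℕ∞) ≤ topDim ((K₁ : Set (Fin n → ℝ)) ∩ (K₂ : Set (Fin n → ℝ))) →
      ‖F K₁ - F K₂‖ ≤ 1

/-- The union of a family of cubes. -/
def unionOf {n k : ℕ} (S : Set (cubes n k)) : Set (Fin n → ℝ) :=
  ⋃ K ∈ S, (K : Set (Fin n → ℝ))

/-- The property required of the constant `C = C_{n,m}`. -/
def HasLevelProperty (n m : ℕ) (C : ℝ) : Prop :=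
  ∀ k : ℕ, 1 ≤ k → ∀ F : cubes n k → (Fin (n - 1) → ℤ), IsAdmissible m F →
    ∃ P : Finset (Fin (n - 1) → ℤ),
      IsRConnected 1 (P : Set (Fin (n - 1) → ℤ)) ∧ (P.card : ℝ) ≤ C ∧
        ∃ S : Set (cubes n k), S ⊆ F ⁻¹' (P : Set (Fin (n - 1) → ℤ)) ∧
          ConnectsSomeFaces (unionOf S)

/-- The set of all constants `C > 0` with the required property. -/
def levelConstants (n m : ℕ) : Set ℝ :=
  {C | 0 < C ∧ HasLevelProperty n m C}

/-- The optimal constant `Ĉ_{n,m}`. -/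
noncomputable def optimalConstant (n m : ℕ) : ℝ :=
  sInf (levelConstants n m)

end Chessboard

/-! Existence of the minimum needs one finite constant. If `dim (K₁ ∩ K₂) ≥ n - 1` for cubes sharing
a facet (`le_topDim_box_inter`), then an `m`-admissible `F` is Lipschitz on the grid of indices.
Colour `ℤⁿ⁻¹` with `n` colours so that monochromatic components at a fixed scale are bounded
(`exists_coloring_bounded_components`), and pull this colouring back along `F`. A coarse Hex theorem
(`exists_monochromatic_chain`) gives a monochromatic chain of cubes between opposite faces. Its
image stays in one component, hence in a box `P` of size depending only on `n`. Since `|P|` is an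
integer, the least natural constant is the minimum.

Both the Hex theorem and the dimension bound rest on a discrete Poincaré–Miranda theorem
(`exists_cell_crossing`), proved by a mod 2 cup product computation.

For the strict inequality, the 27 cubes of the `3 × 3 × 3` grid are coloured by `{0, 1}²` so that no
monochromatic component meets opposite faces (`piece`). In higher dimensions the remaining
coordinates of the index are appended to the colour, so a single level is constant in those
directions and cannot cross them. -/

namespace Chessboard

open Finset Relation

/-! ### Discrete Poincaré–Miranda theorem via mod 2 cup products. -/

section Crossing

variable {ι : Type*} [DecidableEq ι]

/-- The mod 2 cubical cup product `δh₁ ∪ ⋯ ∪ δhᵣ`, evaluated on the cube with lowest vertex `x`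
and directions `J`. -/
def cupDelta : List ((ι → ℕ) → ZMod 2) → Finset ι → (ι → ℕ) → ZMod 2
  | [], _, _ => 1
  | h :: hs, J, x => ∑ j ∈ J, (h (x + Pi.single j 1) + h x) *
      cupDelta hs (J.erase j) (x + Pi.single j 1)

theorem sum_offDiag_symm_eq_zero (J : Finset ι) (s : ι → ι → ZMod 2) (hs : ∀ i j, s i j = s j i) :
    ∑ j ∈ J, ∑ l ∈ J.erase j, s j l = 0 := by
  rw [Finset.sum_sigma']
  refine Finset.sum_involution (fun p _ => ⟨p.2, p.1⟩) ?_ ?_ ?_ ?_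
  · rintro ⟨a, b⟩ _
    rw [hs b a]
    exact CharTwo.add_self_eq_zero _
  · rintro ⟨a, b⟩ h _ heq
    simp only [mem_sigma, mem_erase] at h
    simp only [Sigma.mk.injEq] at heq
    exact h.2.1 heq.1
  · rintro ⟨a, b⟩ h
    simp only [mem_sigma, mem_erase] at h ⊢
    exact ⟨h.2.2, Ne.symm h.2.1, h.1⟩
  · rintro ⟨a, b⟩ _
    rfl

/-- The cup product of coboundaries is a cocycle. -/
theorem cupDelta_closed (hs : List ((ι → ℕ) → ZMod 2)) (J : Finset ι) (x : ι → ℕ) :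
    ∑ j ∈ J, (cupDelta hs (J.erase j) (x + Pi.single j 1) + cupDelta hs (J.erase j) x) = 0 := by
  induction hs generalizing J x with
  | nil => exact Finset.sum_eq_zero fun _ _ => CharTwo.add_self_eq_zero _
  | cons h hs ih =>
    -- Terms are grouped by the vertex at which `h` is evaluated. At the far vertex they are
    -- symmetric in `j, l` and cancel in pairs. At the middle vertices they form `h` times a
    -- coboundary of the shorter product, and at `x` the induction hypothesis reduces them to
    -- another symmetric sum.
    have key : ∀ j l : ι,
        (h (x + Pi.single j 1 + Pi.single l 1) + h (x + Pi.single j 1)) *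
            cupDelta hs ((J.erase j).erase l) (x + Pi.single j 1 + Pi.single l 1) +
          (h (x + Pi.single l 1) + h x) * cupDelta hs ((J.erase j).erase l) (x + Pi.single l 1) =
        h (x + Pi.single j 1 + Pi.single l 1) *
            cupDelta hs ((J.erase j).erase l) (x + Pi.single j 1 + Pi.single l 1) +
          (h (x + Pi.single j 1) *
            cupDelta hs ((J.erase j).erase l) (x + Pi.single j 1 + Pi.single l 1) +
          h (x + Pi.single l 1) * cupDelta hs ((J.erase j).erase l) (x + Pi.single l 1)) +
          h x * cupDelta hs ((J.erase j).erase l) (x + Pi.single l 1) := by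
      intro j l; ring
    have hswap : ∀ f : ι → ι → ZMod 2,
        ∑ j ∈ J, ∑ l ∈ J.erase j, f j l = ∑ j ∈ J, ∑ l ∈ J.erase j, f l j := by
      intro f
      refine Finset.sum_comm' fun a b => ?_
      simp only [mem_erase]
      tauto
    simp only [cupDelta, ← Finset.sum_add_distrib, key]
    simp only [Finset.sum_add_distrib]
    have h1 : ∑ j ∈ J, ∑ l ∈ J.erase j, h (x + Pi.single j 1 + Pi.single l 1) *
        cupDelta hs ((J.erase j).erase l) (x + Pi.single j 1 + Pi.single l 1) = 0 := by
      refine sum_offDiag_symm_eq_zero J (fun j l => h (x + Pi.single j 1 + Pi.single l 1) *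
        cupDelta hs ((J.erase j).erase l) (x + Pi.single j 1 + Pi.single l 1)) fun i j => ?_
      rw [add_right_comm, Finset.erase_right_comm]
    have h2 : ∑ j ∈ J, ∑ l ∈ J.erase j, h (x + Pi.single j 1) *
          cupDelta hs ((J.erase j).erase l) (x + Pi.single j 1 + Pi.single l 1) +
        ∑ j ∈ J, ∑ l ∈ J.erase j, h (x + Pi.single l 1) *
          cupDelta hs ((J.erase j).erase l) (x + Pi.single l 1) = 0 := by
      have hs' := hswap fun j l => h (x + Pi.single l 1) *
          cupDelta hs ((J.erase j).erase l) (x + Pi.single l 1)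
      beta_reduce at hs'
      rw [hs', ← Finset.sum_add_distrib]
      refine Finset.sum_eq_zero fun j _ => ?_
      rw [← mul_zero (h (x + Pi.single j 1)), ← ih (J.erase j) (x + Pi.single j 1),
        Finset.mul_sum, ← Finset.sum_add_distrib]
      refine Finset.sum_congr rfl fun l _ => ?_
      rw [Finset.erase_right_comm (s := J) (a := l), mul_add]
    have h3 : ∑ j ∈ J, ∑ l ∈ J.erase j, h x *
          cupDelta hs ((J.erase j).erase l) (x + Pi.single l 1) = 0 := by
      simp only [← Finset.mul_sum]
      have h4 : ∑ j ∈ J, ∑ l ∈ J.erase j, cupDelta hs ((J.erase j).erase l) x = 0 :=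
        sum_offDiag_symm_eq_zero J (fun j l => cupDelta hs ((J.erase j).erase l) x)
          fun i j => by rw [Finset.erase_right_comm]
      have h5 : ∑ j ∈ J, ∑ l ∈ J.erase j,
          cupDelta hs ((J.erase j).erase l) (x + Pi.single l 1) = 0 := by
        refine (CharTwo.add_eq_zero.1 ?_).trans h4
        rw [← Finset.sum_add_distrib]
        refine Finset.sum_eq_zero fun j _ => ?_
        rw [← Finset.sum_add_distrib, ih]
      rw [h5, mul_zero]
    rw [h1, h3, zero_add, add_zero, h2]

/-- Leibniz rule: `δh ∪ c = δ(h ∪ c)` because `c` is a cocycle. Being a coboundary makes the product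
summable by Stokes. -/
theorem cupDelta_cons (h : (ι → ℕ) → ZMod 2) (hs : List ((ι → ℕ) → ZMod 2)) (J : Finset ι)
    (x : ι → ℕ) :
    cupDelta (h :: hs) J x = ∑ j ∈ J, (h (x + Pi.single j 1) *
      cupDelta hs (J.erase j) (x + Pi.single j 1) + h x * cupDelta hs (J.erase j) x) := by
  rw [← add_zero (cupDelta (h :: hs) J x), ← mul_zero (h x), ← cupDelta_closed hs J x,
    Finset.mul_sum, cupDelta, ← Finset.sum_add_distrib]
  refine Finset.sum_congr rfl fun j _ => ?_
  linear_combination (h x * cupDelta hs (J.erase j) (x + Pi.single j 1)) *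
    (CharTwo.two_eq_zero : (2 : ZMod 2) = 0)

/-- The vertices of the cube with lowest vertex `x` and directions `J`. -/
def cellVertices (J : Finset ι) (x : ι → ℕ) : Set (ι → ℕ) :=
  {y | ∀ s, x s ≤ y s ∧ y s ≤ x s + if s ∈ J then 1 else 0}

/-- Every term of the expanded product contains a difference of `h` along an edge of the cell. -/
theorem cupDelta_eq_zero {hs : List ((ι → ℕ) → ZMod 2)} {J : Finset ι} {x : ι → ℕ}
    {h : (ι → ℕ) → ZMod 2} (hmem : h ∈ hs)
    (hconst : ∀ a ∈ cellVertices J x, ∀ b ∈ cellVertices J x, h a = h b) :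
    cupDelta hs J x = 0 := by
  induction hs generalizing J x with
  | nil => simp at hmem
  | cons h' hs ih =>
    rw [cupDelta]
    refine Finset.sum_eq_zero fun j hj => ?_
    have hsub : cellVertices (J.erase j) (x + Pi.single j 1) ⊆ cellVertices J x := by
      intro y hy s
      have := hy s
      by_cases hsj : s = j
      · subst hsj
        simp at this
        simp [hj]; omega
      · simp [hsj] at this
        exact ⟨this.1, this.2⟩
    rcases List.mem_cons.1 hmem with rfl | hmem'
    · rw [hconst (x + Pi.single j 1) ?_ x ?_, CharTwo.add_self_eq_zero, zero_mul]
      · intro s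
        by_cases hsj : s = j
        · subst hsj; simp [hj]
        · simp [hsj]
      · intro s; simp
    · rw [ih hmem' fun a ha b hb => hconst a (hsub ha) b (hsub hb), mul_zero]

variable [Fintype ι]

theorem sum_piFinset_update (S : ι → Finset ℕ) (j : ι) (u : (ι → ℕ) → ZMod 2) :
    ∑ x ∈ Fintype.piFinset S, u x =
      ∑ a ∈ S j, ∑ x ∈ Fintype.piFinset (Function.update S j {a}), u x := by
  rw [Finset.sum_sigma']
  refine Finset.sum_bij' (fun x _ => (⟨x j, x⟩ : Σ _ : ℕ, ι → ℕ)) (fun p _ => p.2) ?_ ?_ ?_ ?_ ?_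
  · intro x hx
    rw [Fintype.mem_piFinset] at hx
    simp only [mem_sigma, Fintype.mem_piFinset]
    refine ⟨hx j, fun s => ?_⟩
    by_cases hs : s = j
    · subst hs; simp
    · simp [hs, hx s]
  · rintro ⟨a, x⟩ hx
    simp only [mem_sigma, Fintype.mem_piFinset] at hx ⊢
    intro s
    have := hx.2 s
    by_cases hs : s = j
    · subst hs; simp at this; rw [this]; exact hx.1
    · simpa [hs] using this
  · intros; rfl
  · rintro ⟨a, x⟩ hx
    simp only [mem_sigma, Fintype.mem_piFinset] at hx
    have := hx.2 j
    simp at this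
    simp [this]
  · intros; rfl

theorem sum_piFinset_shift (S : ι → Finset ℕ) (j : ι) (a : ℕ) (u : (ι → ℕ) → ZMod 2) :
    ∑ x ∈ Fintype.piFinset (Function.update S j {a}), u (x + Pi.single j 1) =
      ∑ x ∈ Fintype.piFinset (Function.update S j {a + 1}), u x := by
  refine Finset.sum_bij' (fun x _ => x + Pi.single j 1) (fun x _ => Function.update x j a)
    ?_ ?_ ?_ ?_ ?_
  · intro x hx
    rw [Fintype.mem_piFinset] at hx ⊢
    intro s
    have := hx s
    by_cases hs : s = j
    · subst hs; simp at this; simp [this]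
    · simpa [hs] using this
  · intro x hx
    rw [Fintype.mem_piFinset] at hx ⊢
    intro s
    have := hx s
    by_cases hs : s = j
    · subst hs; simp
    · simpa [hs] using this
  · intro x hx
    rw [Fintype.mem_piFinset] at hx
    have := hx j
    simp at this
    ext s
    by_cases hs : s = j
    · subst hs; simp [this]
    · simp [hs]
  · intro x hx
    rw [Fintype.mem_piFinset] at hx
    have := hx j
    simp at this
    ext s
    by_cases hs : s = j
    · subst hs; simp [this]
    · simp [hs]
  · intros; rfl

theorem sum_piFinset_telescope (S : ι → Finset ℕ) (j : ι) (k : ℕ) (hS : S j = range k)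
    (u : (ι → ℕ) → ZMod 2) :
    ∑ x ∈ Fintype.piFinset S, (u (x + Pi.single j 1) + u x) =
      ∑ x ∈ Fintype.piFinset (Function.update S j {k}), u x +
        ∑ x ∈ Fintype.piFinset (Function.update S j {0}), u x := by
  rw [sum_piFinset_update S j, hS]
  simp only [Finset.sum_add_distrib, sum_piFinset_shift]
  rw [← Finset.sum_add_distrib]
  have := Finset.sum_range_sub
    (fun a => ∑ x ∈ Fintype.piFinset (Function.update S j {a}), u x) k
  simpa only [CharTwo.sub_eq_add] using this

/-- The ranges of the coordinates of the lowest vertices of the cells, with directions `J`, of the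
face of `[0, k]^ι` where the coordinates outside `J` are equal to `k`. -/
def cellRanges (k : ℕ) (J : Finset ι) (s : ι) : Finset ℕ := if s ∈ J then range k else {k}

/-- By Stokes the sum moves to the boundary. On the faces in a direction `j ≠ i` the factor `δ(h j)`
vanishes, and on the lower `i`-th face `h i = 0`. Only the upper `i`-th face remains; there `h i =
1`, which leaves the same sum with one factor fewer. -/
theorem sum_cupDelta_eq_one (k : ℕ) (h : ι → (ι → ℕ) → ZMod 2)
    (h0 : ∀ i x, (∀ s, x s ≤ k) → x i = 0 → h i x = 0)
    (h1 : ∀ i x, (∀ s, x s ≤ k) → x i = k → h i x = 1) (l : List ι) (hl : l.Nodup) :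
    ∑ x ∈ Fintype.piFinset (cellRanges k l.toFinset), cupDelta (l.map h) l.toFinset x = 1 := by
  induction l with
  | nil =>
    have : cellRanges k (∅ : Finset ι) = fun _ : ι => {k} := by
      ext; simp [cellRanges]
    simp [cupDelta, this]
  | cons i l ih =>
    obtain ⟨hil, hl⟩ := List.nodup_cons.1 hl
    set J := (i :: l).toFinset with hJ
    have hJi : J.erase i = l.toFinset := by
      rw [hJ, List.toFinset_cons, Finset.erase_insert]
      simpa using hil
    have hiJ : i ∈ J := by simp [hJ]
    have hupd : ∀ j, Function.update (cellRanges k J) j {k} = cellRanges k (J.erase j) := by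
      intro j
      ext s : 1
      by_cases hs : s = j
      · subst hs; simp [cellRanges]
      · simp [cellRanges, hs]
    simp only [List.map_cons, cupDelta_cons]
    rw [Finset.sum_comm]
    have htel : ∀ j ∈ J, ∑ x ∈ Fintype.piFinset (cellRanges k J),
        (h i (x + Pi.single j 1) * cupDelta (l.map h) (J.erase j) (x + Pi.single j 1) +
          h i x * cupDelta (l.map h) (J.erase j) x) = _ := fun j hj =>
      sum_piFinset_telescope (cellRanges k J) j k (by simp [cellRanges, hj])
        fun x => h i x * cupDelta (l.map h) (J.erase j) x
    rw [Finset.sum_congr rfl htel]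
    have hbound : ∀ (j : ι) (v : ℕ), v ≤ k → ∀ x ∈ Fintype.piFinset
        (Function.update (cellRanges k J) j {v}), x j = v ∧
          ∀ y ∈ cellVertices (J.erase j) x, y j = v ∧ ∀ s, y s ≤ k := by
      intro j v hv x hx
      rw [Fintype.mem_piFinset] at hx
      have hxj : x j = v := by simpa using hx j
      refine ⟨hxj, fun y hy => ⟨?_, fun s => ?_⟩⟩
      · have := hy j
        simp at this; omega
      · have h2 := hx s
        have h3 := hy s
        by_cases hs : s = j
        · subst hs; simp at h3; omega
        · by_cases hsJ : s ∈ J <;> simp [cellRanges, hs, hsJ] at h2 h3 <;> omega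
    have hself : ∀ (K : Finset ι) (x : ι → ℕ), x ∈ cellVertices K x := fun K x s => by simp
    have hzero : ∀ j ∈ J, j ≠ i → ∀ v, v = 0 ∨ v = k → ∑ x ∈ Fintype.piFinset
        (Function.update (cellRanges k J) j {v}),
          h i x * cupDelta (l.map h) (J.erase j) x = 0 := by
      intro j hj hji v hv
      refine Finset.sum_eq_zero fun x hx => ?_
      have hb := (hbound j v (by omega) x hx).2
      rw [cupDelta_eq_zero (h := h j), mul_zero]
      · refine List.mem_map_of_mem ?_
        simpa [hJ, hji] using hj
      · intro a ha b hb'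
        rcases hv with rfl | rfl
        · rw [h0 j a (hb a ha).2 (hb a ha).1, h0 j b (hb b hb').2 (hb b hb').1]
        · rw [h1 j a (hb a ha).2 (hb a ha).1, h1 j b (hb b hb').2 (hb b hb').1]
    rw [Finset.sum_eq_single i (fun j hj hji => by
      rw [hzero j hj hji k (Or.inr rfl), hzero j hj hji 0 (Or.inl rfl), add_zero])
      (fun hi => absurd hiJ hi)]
    have hz : ∑ x ∈ Fintype.piFinset (Function.update (cellRanges k J) i {0}),
        h i x * cupDelta (l.map h) (J.erase i) x = 0 := by
      refine Finset.sum_eq_zero fun x hx => ?_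
      obtain ⟨hxi, hb⟩ := hbound i 0 (Nat.zero_le _) x hx
      rw [h0 i x (hb x (hself _ _)).2 hxi, zero_mul]
    rw [hz, add_zero, ← ih hl, ← hJi, ← hupd]
    refine Finset.sum_congr rfl fun x hx => ?_
    obtain ⟨hxi, hb⟩ := hbound i k le_rfl x hx
    rw [h1 i x (hb x (hself _ _)).2 hxi, one_mul]

/-- A discrete Poincaré–Miranda theorem: if for every `i` the set `H i` of vertices of `[0, k]^ι`
contains the lower `i`-th face and misses the upper `i`-th face, then some cell meets each `H i`
and each complement. -/
theorem exists_cell_crossing (k : ℕ) (H : ι → Set (ι → ℕ))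
    (h0 : ∀ i x, (∀ s, x s ≤ k) → x i = 0 → x ∈ H i)
    (h1 : ∀ i x, (∀ s, x s ≤ k) → x i = k → x ∉ H i) :
    ∃ x : ι → ℕ, (∀ s, x s < k) ∧ ∀ i, (∃ a ∈ H i, ∀ s, x s ≤ a s ∧ a s ≤ x s + 1) ∧
      ∃ b ∉ H i, ∀ s, x s ≤ b s ∧ b s ≤ x s + 1 := by
  classical
  have hsum := sum_cupDelta_eq_one k (fun i x => if x ∈ H i then 0 else 1)
    (fun i x hx hxi => if_pos (h0 i x hx hxi)) (fun i x hx hxi => if_neg (h1 i x hx hxi))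
    univ.toList univ.nodup_toList
  obtain ⟨x, hx, hne⟩ := Finset.exists_ne_zero_of_sum_ne_zero (hsum.trans_ne one_ne_zero)
  simp only [Finset.toList_toFinset, Fintype.mem_piFinset, cellRanges, mem_univ, if_true,
    mem_range] at hx
  refine ⟨x, hx, fun i => ?_⟩
  by_contra hcon
  refine hne (cupDelta_eq_zero (h := fun x => if x ∈ H i then 0 else 1)
    (List.mem_map.2 ⟨i, by simp, rfl⟩) fun a ha b hb => ?_)
  simp only [cellVertices, Finset.toList_toFinset, mem_univ, if_true, Set.mem_ofPred_eq] at ha hb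
  split_ifs with h2 h3 h3
  · rfl
  · exact absurd ⟨⟨a, h2, ha⟩, ⟨b, h3, hb⟩⟩ hcon
  · exact absurd ⟨⟨b, h3, hb⟩, ⟨a, h2, ha⟩⟩ hcon
  · rfl

end Crossing

/-! ### Lower bound for the small inductive dimension, via unstable values. -/

section Dimension

/-- The Poincaré–Miranda theorem. -/
theorem exists_zero_of_opposite_signs {ι : Type*} [Fintype ι] [DecidableEq ι]
    (g : (ι → ℝ) → ι → ℝ) (hg : Continuous g)
    (h0 : ∀ i x, x ∈ Set.Icc (0 : ι → ℝ) 1 → x i = 0 → g x i < 0)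
    (h1 : ∀ i x, x ∈ Set.Icc (0 : ι → ℝ) 1 → x i = 1 → 0 < g x i) :
    ∃ x ∈ Set.Icc (0 : ι → ℝ) 1, g x = 0 := by
  by_contra! hcon
  have hcomp : IsCompact (Set.Icc (0 : ι → ℝ) 1) := isCompact_Icc
  obtain ⟨p, hp, hmin⟩ := hcomp.exists_isMinOn ⟨0, le_rfl, zero_le_one⟩
    (continuous_norm.comp hg).continuousOn
  have hpos : 0 < ‖g p‖ := norm_pos_iff.2 (hcon p hp)
  obtain ⟨δ, hδ, huc⟩ := Metric.uniformContinuousOn_iff.1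
    (hcomp.uniformContinuousOn_of_continuous hg.continuousOn) _ hpos
  obtain ⟨k, hk⟩ := exists_nat_one_div_lt hδ
  have hk0 : (0 : ℝ) < k + 1 := by positivity
  let c : (ι → ℕ) → ι → ℝ := fun x s => (x s : ℝ) / (k + 1)
  have hc : ∀ x : ι → ℕ, (∀ s, x s ≤ k + 1) → c x ∈ Set.Icc (0 : ι → ℝ) 1 := fun x hx =>
    ⟨fun s => by simp only [c, Pi.zero_apply]; positivity, fun s => by
      simp only [c, Pi.one_apply]
      rw [div_le_one hk0]
      exact_mod_cast hx s⟩
  obtain ⟨x, hx, hcross⟩ := exists_cell_crossing (k + 1) (fun i => {x | g (c x) i < 0})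
    (fun i x hx hxi => h0 i _ (hc x hx) (by simp [c, hxi]))
    (fun i x hx hxi => not_lt.2 (h1 i _ (hc x hx) (by
      simp only [c, hxi]; push_cast; exact div_self hk0.ne')).le)
  have hxc := hc x fun s => (hx s).le
  have hnear : ∀ a : ι → ℕ, (∀ s, x s ≤ a s ∧ a s ≤ x s + 1) → ∀ i,
      |g (c a) i - g (c x) i| < ‖g p‖ := by
    intro a ha i
    refine lt_of_le_of_lt ?_ (huc (c a) (hc a fun s => by have := hx s; have := ha s; omega)
      (c x) hxc ?_)
    · rw [← Real.dist_eq]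
      exact dist_le_pi_dist _ _ i
    · refine lt_of_le_of_lt ((dist_pi_le_iff (by positivity)).2 fun s => ?_) hk
      have h2 : (x s : ℝ) ≤ a s := by exact_mod_cast (ha s).1
      have h3 : (a s : ℝ) ≤ x s + 1 := by exact_mod_cast (ha s).2
      simp only [c]
      rw [Real.dist_eq, ← sub_div, abs_of_nonneg (div_nonneg (by linarith) hk0.le)]
      gcongr
      linarith
  -- In a crossing cell each coordinate of `g` changes sign within less than `‖g p‖` of its value at
  -- `c x`, so `‖g (c x)‖` would fall below the minimum.
  have hle : ‖g p‖ ≤ ‖g (c x)‖ := hmin hxc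
  refine hle.not_gt ?_
  refine (pi_norm_lt_iff hpos).2 fun i => ?_
  obtain ⟨⟨a, haH, ha⟩, b, hbH, hb⟩ := hcross i
  have h2 := abs_lt.1 (hnear a ha i)
  have h3 := abs_lt.1 (hnear b hb i)
  simp only [Set.mem_ofPred_eq, not_lt] at haH hbH
  rw [Real.norm_eq_abs, abs_lt]
  constructor <;> linarith [h2.1, h2.2, h3.1, h3.2]

/-- Every continuous map to `ℝʳ` has arbitrarily small perturbations without zeros on `K`. -/
def AvoidsZero {X : Type*} [TopologicalSpace X] (r : ℕ) (K : Set X) : Prop :=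
  ∀ f : X → Fin r → ℝ, Continuous f → ∀ ε > 0, ∃ g : X → Fin r → ℝ, Continuous g ∧
    (∀ x, dist (g x) (f x) ≤ ε) ∧ ∀ x ∈ K, g x ≠ 0

theorem AvoidsZero.empty {X : Type*} [TopologicalSpace X] (r : ℕ) :
    AvoidsZero r (∅ : Set X) := fun f hf ε hε =>
  ⟨f, hf, fun x => by rw [dist_self]; exact hε.le, fun x hx => absurd hx (Set.notMem_empty x)⟩

/-- After the first perturbation the norm is bounded below on the compact set `K`; a second, smaller
perturbation cannot create zeros there. -/
theorem AvoidsZero.union {X : Type*} [TopologicalSpace X] {r : ℕ} {K K' : Set X}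
    (hK : IsCompact K) (h : AvoidsZero r K) (h' : AvoidsZero r K') : AvoidsZero r (K ∪ K') := by
  intro f hf ε hε
  obtain ⟨g, hg, hgf, hgK⟩ := h f hf (ε / 2) (half_pos hε)
  obtain ⟨δ, hδ, hgδ⟩ : ∃ δ > 0, ∀ x ∈ K, δ ≤ ‖g x‖ := by
    rcases K.eq_empty_or_nonempty with rfl | hne
    · exact ⟨1, one_pos, fun x hx => absurd hx (Set.notMem_empty x)⟩
    · obtain ⟨p, hp, hmin⟩ := hK.exists_isMinOn hne (continuous_norm.comp hg).continuousOn
      exact ⟨‖g p‖, norm_pos_iff.2 (hgK p hp), fun x hx => hmin hx⟩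
  obtain ⟨g', hg', hgg, hgK'⟩ := h' g hg (min (ε / 2) (δ / 2)) (by positivity)
  refine ⟨g', hg', fun x => ?_, ?_⟩
  · linarith [dist_triangle (g' x) (g x) (f x), hgf x, hgg x, min_le_left (ε / 2) (δ / 2)]
  · rintro x (hx | hx) h0
    · have h1 := hgg x
      rw [h0, dist_zero_left] at h1
      linarith [hgδ x hx, min_le_right (ε / 2) (δ / 2)]
    · exact hgK' x hx h0

theorem AvoidsZero.biUnion {X α : Type*} [TopologicalSpace X] {r : ℕ} {K : α → Set X}
    {t : Set α} (ht : t.Finite) (hK : ∀ a ∈ t, IsCompact (K a))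
    (h : ∀ a ∈ t, AvoidsZero r (K a)) : AvoidsZero r (⋃ a ∈ t, K a) := by
  induction t, ht using Set.Finite.induction_on with
  | empty => simpa using AvoidsZero.empty r
  | insert ha ht ih =>
    rw [Set.biUnion_insert]
    exact (h _ (Set.mem_insert _ _)).union (hK _ (Set.mem_insert _ _))
      (ih (fun b hb => hK b (Set.mem_insert_of_mem _ hb))
        fun b hb => h b (Set.mem_insert_of_mem _ hb))

theorem exists_continuous_le_eq_zero_iff {X : Type*} [MetricSpace X] {C : Set X}
    (hC : IsClosed C) {ε : ℝ} (hε : 0 < ε) :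
    ∃ φ : X → ℝ, Continuous φ ∧ (∀ x, 0 ≤ φ x ∧ φ x ≤ ε) ∧ ∀ x, φ x = 0 ↔ x ∈ C := by
  rcases C.eq_empty_or_nonempty with rfl | hne
  · exact ⟨fun _ => ε, continuous_const, fun _ => ⟨hε.le, le_rfl⟩, fun x => by simp [hε.ne']⟩
  · refine ⟨fun x => min ε (Metric.infDist x C),
      continuous_const.min (Metric.continuous_infDist_pt C),
      fun x => ⟨le_min hε.le Metric.infDist_nonneg, min_le_left _ _⟩, fun x => ?_⟩
    rw [hC.mem_iff_infDist_zero hne]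
    beta_reduce
    constructor
    · intro h
      rcases min_choice ε (Metric.infDist x C) with h' | h' <;> rw [h'] at h
      · exact absurd h hε.ne'
      · exact h
    · intro h
      rw [h, min_eq_right hε.le]

/-- A function can be changed by at most `2 ε` such that its zeros on `K` lie in the frontier, in
`K`, of a relatively open set separating the points where it is small from those where it is
large. -/
theorem exists_perturbation_zeros_subset_frontier {X Y : Type*} [MetricSpace X]
    [TopologicalSpace Y] {e : Y → X} (he : Topology.IsClosedEmbedding e) {f : X → ℝ}
    (hf : Continuous f) {ε : ℝ} (hε : 0 < ε) {V : Set Y} (hV : IsOpen V)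
    (hVl : ∀ y, f (e y) ≤ -ε → y ∈ V) (hVu : ∀ y ∈ closure V, f (e y) < ε) :
    ∃ g : X → ℝ, Continuous g ∧ (∀ x, |g x - f x| ≤ 2 * ε) ∧
      ∀ y, g (e y) = 0 → y ∈ frontier V := by
  obtain ⟨φ, hφ, hφb, hφ0⟩ :=
    exists_continuous_le_eq_zero_iff (he.isClosedMap _ (isClosed_closure (s := V))) hε
  obtain ⟨ψ, hψ, hψb, hψ0⟩ :=
    exists_continuous_le_eq_zero_iff (he.isClosedMap _ hV.isClosed_compl) hε
  -- Subtracting the truncation of `f` to `[-ε, ε]` flattens the small values to zero. Then `-ψ`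
  -- makes the result negative on `V`, and `φ` makes it positive off `closure V`.
  refine ⟨fun x => f x - max (-ε) (min ε (f x)) + (φ x - ψ x), by fun_prop, fun x => ?_, ?_⟩
  · have h1 : -ε ≤ max (-ε) (min ε (f x)) := le_max_left _ _
    have h2 : max (-ε) (min ε (f x)) ≤ ε := max_le (by linarith) (min_le_left _ _)
    rw [abs_le]
    constructor <;> linarith [(hφb x).1, (hφb x).2, (hψb x).1, (hψb x).2]
  · intro y hy
    by_contra hfr
    have hmem : ∀ S : Set Y, e y ∈ e '' S ↔ y ∈ S := fun S => he.injective.mem_set_image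
    rw [hV.frontier_eq, Set.mem_sdiff, not_and_not_right] at hfr
    by_cases hyV : y ∈ V
    · have h1 : φ (e y) = 0 := (hφ0 _).2 ((hmem _).2 (subset_closure hyV))
      have h2 : ψ (e y) ≠ 0 := fun h => ((hmem _).1 ((hψ0 _).1 h)) hyV
      have h3 : 0 < ψ (e y) := lt_of_le_of_ne (hψb _).1 h2.symm
      have h4 := hVu y (subset_closure hyV)
      have h5 : f (e y) ≤ max (-ε) (min ε (f (e y))) := by
        rw [min_eq_right h4.le]; exact le_max_right _ _
      linarith
    · have h1 : ψ (e y) = 0 := (hψ0 _).2 ((hmem _).2 hyV)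
      have h2 : φ (e y) ≠ 0 := fun h => hyV (hfr ((hmem _).1 ((hφ0 _).1 h)))
      have h3 : 0 < φ (e y) := lt_of_le_of_ne (hφb _).1 h2.symm
      have h4 : -ε < f (e y) := not_le.1 fun h => hyV (hVl y h)
      have h5 : max (-ε) (min ε (f (e y))) ≤ f (e y) := max_le h4.le (min_le_right _ _)
      linarith

/-- Finiteness of the cover of `A`, from compactness, makes closure commute with the union, so the
frontier of the union is controlled by frontiers of basis sets. -/
theorem exists_finite_basis_separation {Y : Type*} [TopologicalSpace Y] [CompactSpace Y]
    [T3Space Y] {s : Set (Set Y)} (hs : TopologicalSpace.IsTopologicalBasis s) {A B : Set Y}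
    (hA : IsClosed A) (hB : IsClosed B) (hAB : Disjoint A B) :
    ∃ t : Set (Set Y), t.Finite ∧ t ⊆ s ∧ A ⊆ ⋃₀ t ∧ Disjoint (closure (⋃₀ t)) B ∧
      frontier (⋃₀ t) ⊆ ⋃ U ∈ t, frontier U := by
  have hloc : ∀ y : A, ∃ U ∈ s, (y : Y) ∈ U ∧ closure U ⊆ Bᶜ := fun y =>
    hs.exists_closure_subset (hB.isOpen_compl.mem_nhds fun h =>
      Set.disjoint_left.1 hAB y.2 h)
  choose U hUs hyU hUB using hloc
  obtain ⟨T, hT⟩ := hA.isCompact.elim_finite_subcover U (fun y => hs.isOpen (hUs y))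
    fun y hy => Set.mem_iUnion.2 ⟨⟨y, hy⟩, hyU _⟩
  have hfin : (U '' T).Finite := T.finite_toSet.image U
  have hcl : closure (⋃₀ (U '' T)) = ⋃ V ∈ U '' T, closure V := by
    rw [Set.sUnion_eq_biUnion, hfin.closure_biUnion]
  have hsub : U '' T ⊆ s := by rintro _ ⟨y, _, rfl⟩; exact hUs y
  refine ⟨U '' T, hfin, hsub, ?_, ?_, ?_⟩
  · simpa [Set.sUnion_image] using hT
  · rw [hcl, Set.disjoint_iUnion₂_left]
    rintro _ ⟨y, _, rfl⟩
    exact Set.disjoint_left.2 fun z hz => hUB y hz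
  · intro y hy
    rw [(isOpen_sUnion fun V hV => hs.isOpen (hsub hV)).frontier_eq, hcl] at hy
    obtain ⟨V, hV, hyV⟩ := Set.mem_iUnion₂.1 hy.1
    refine Set.mem_iUnion₂.2 ⟨V, hV, ?_⟩
    rw [(hs.isOpen (hsub hV)).frontier_eq]
    exact ⟨hyV, fun h => hy.2 (Set.mem_sUnion_of_mem h hV)⟩

/-- Compact subsets of metric spaces of small inductive dimension less than `d` have unstable
values in `ℝᵈ`. -/
theorem avoidsZero_range_of_hasSmallInductiveDimensionLT {X Y : Type*} [MetricSpace X]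
    [TopologicalSpace Y] {d : ℕ} (hY : HasSmallInductiveDimensionLT Y d) (hc : CompactSpace Y)
    {e : Y → X} (he : Topology.IsClosedEmbedding e) : AvoidsZero d (Set.range e) := by
  -- The ambient space `X` stays fixed while `Y` shrinks to frontiers of basis sets. Perturbing the
  -- first coordinate confines its zeros to finitely many such frontiers, and there the induction
  -- hypothesis frees the remaining coordinates of common zeros.
  induction hY with
  | zero => rw [Set.range_eq_empty]; exact AvoidsZero.empty _
  | @succ Y _ d s hs h ih =>
    intro f hf ε hε
    have : T3Space Y := he.isEmbedding.t3Space
    have hf0 : Continuous fun x => f x 0 := (continuous_apply 0).comp hf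
    have hfe : Continuous fun y => f (e y) 0 := hf0.comp he.continuous
    obtain ⟨t, htf, hts, htA, htB, htfr⟩ := exists_finite_basis_separation hs
      (isClosed_le hfe (continuous_const (y := -(ε / 2))))
      (isClosed_le (continuous_const (y := ε / 2)) hfe)
      (Set.disjoint_left.2 fun y (h1 : f (e y) 0 ≤ _) (h2 : _ ≤ f (e y) 0) => by linarith)
    obtain ⟨g₀, hg₀, hgf₀, hz₀⟩ := exists_perturbation_zeros_subset_frontier he hf0
      (half_pos hε) (isOpen_sUnion fun V hV => hs.isOpen (hts hV)) (fun y hy => htA hy)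
      (fun y hy => not_le.1 fun h => Set.disjoint_left.1 htB hy h)
    have hfr : ∀ U ∈ t, AvoidsZero d (e '' frontier U) := by
      intro U hU
      have : CompactSpace (frontier U) := isCompact_iff_compactSpace.1 isClosed_frontier.isCompact
      have := ih U (hts hU) this (he.comp isClosed_frontier.isClosedEmbedding_subtypeVal)
      rwa [Set.range_comp, Subtype.range_coe] at this
    have hall := AvoidsZero.biUnion htf
      (fun U _ => isClosed_frontier.isCompact.image he.continuous) hfr
    obtain ⟨g₁, hg₁, hgf₁, hz₁⟩ := hall (fun x => Fin.tail (f x))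
      (continuous_pi fun i => (continuous_apply i.succ).comp hf) ε hε
    refine ⟨fun x => Fin.cons (g₀ x) (g₁ x), ?_, fun x => ?_, ?_⟩
    · refine continuous_pi fun i => ?_
      refine Fin.cases ?_ (fun j => ?_) i
      · simpa using hg₀
      · simpa [Function.comp_def] using (continuous_apply j).comp hg₁
    · refine (dist_pi_le_iff hε.le).2 fun i => ?_
      refine Fin.cases ?_ (fun j => ?_) i
      · beta_reduce
        rw [Fin.cons_zero, Real.dist_eq]
        linarith [hgf₀ x]
      · beta_reduce
        rw [Fin.cons_succ]
        exact (dist_le_pi_dist (g₁ x) (Fin.tail (f x)) j).trans (hgf₁ x)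
    · rintro _ ⟨y, rfl⟩ h0
      have h1 : g₀ (e y) = 0 := by simpa using congrFun h0 0
      have h2 : g₁ (e y) = 0 := by
        ext j
        simpa using congrFun h0 j.succ
      obtain ⟨U, hU, hyU⟩ := Set.mem_iUnion₂.1 (htfr (hz₀ y h1))
      exact hz₁ (e y) (Set.mem_iUnion₂.2 ⟨U, hU, y, hyU, rfl⟩) h2

/-- A set containing a face of a box, of dimension `d`, has topological dimension at least `d`. -/
theorem le_topDim_of_face_subset {d : ℕ} {K : Set (Fin (d + 1) → ℝ)} (hK : IsCompact K)
    (t : Fin (d + 1)) (v : ℝ) (lo : Fin (d + 1) → ℝ) {w : ℝ} (hw : 0 < w)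
    (hface : ∀ x, x t = v → (∀ s ≠ t, lo s ≤ x s ∧ x s ≤ lo s + w) → x ∈ K) :
    (d : WithBot ℕ∞) ≤ topDim K := by
  by_contra hlt
  have : CompactSpace K := isCompact_iff_compactSpace.1 hK
  have hav := avoidsZero_range_of_hasSmallInductiveDimensionLT
    (smallInductiveDimension_lt_iff.1 (not_le.1 hlt)) this hK.isClosed.isClosedEmbedding_subtypeVal
  rw [Subtype.range_coe] at hav
  -- The map rescales the face to a cube centred at the origin, with values `±1/2` on opposite
  -- sides. An error of `1/4` preserves these signs, so Poincaré–Miranda forces a zero of `g`.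
  obtain ⟨g, hg, hgf, hgK⟩ := hav
    (fun x j => (x (t.succAbove j) - lo (t.succAbove j)) / w - 1 / 2)
    (by fun_prop) (1 / 4) (by norm_num)
  let φ : (Fin d → ℝ) → Fin (d + 1) → ℝ := fun u =>
    t.insertNth v fun j => lo (t.succAbove j) + u j * w
  have hφ : Continuous φ :=
    Continuous.finInsertNth t continuous_const (by fun_prop)
  have hnear : ∀ u j, |g (φ u) j - (u j - 1 / 2)| ≤ 1 / 4 := by
    intro u j
    have h1 := (dist_le_pi_dist _ _ j).trans (hgf (φ u))
    rw [Real.dist_eq] at h1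
    have h2 : φ u (t.succAbove j) = lo (t.succAbove j) + u j * w := by
      simp [φ]
    rw [h2, add_sub_cancel_left, mul_div_assoc, div_self hw.ne', mul_one] at h1
    exact h1
  obtain ⟨u, hu, hu0⟩ := exists_zero_of_opposite_signs (fun u => g (φ u)) (hg.comp hφ)
    (fun j u _ huj => by
      have := abs_le.1 (hnear u j)
      rw [huj] at this
      linarith [this.1, this.2])
    (fun j u _ huj => by
      have := abs_le.1 (hnear u j)
      rw [huj] at this
      linarith [this.1, this.2])
  refine hgK (φ u) (hface _ (by simp [φ]) fun s hs => ?_) hu0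
  obtain ⟨j, rfl⟩ := Fin.exists_succAbove_eq hs
  have h2 : φ u (t.succAbove j) = lo (t.succAbove j) + u j * w := by simp [φ]
  have h3 : 0 ≤ u j := hu.1 j
  have h4 : u j ≤ 1 := hu.2 j
  rw [h2]
  constructor <;> nlinarith

end Dimension

/-! ### A finite constant: coarse Hex and asymptotic dimension. -/

section UpperBound

/-- `i` is the index of one of the cubes of `cubes n k`. -/
def IsIndex {ι : Type*} (k : ℕ) (i : ι → ℕ) : Prop := ∀ s, 1 ≤ i s ∧ i s ≤ k

/-- `i` and `j` are at `ℓ^∞`-distance at most `r`. -/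
def Close {ι : Type*} (r : ℕ) (i j : ι → ℕ) : Prop := ∀ s, i s ≤ j s + r ∧ j s ≤ i s + r

theorem Close.symm {ι : Type*} {r : ℕ} {i j : ι → ℕ} (h : Close r i j) : Close r j i :=
  fun s => (h s).symm

/-- A coarse version of the Steinhaus chessboard theorem (the theorem on the game of Hex). -/
theorem exists_monochromatic_chain {ι : Type*} [Fintype ι] [DecidableEq ι] {k : ℕ} (hk : 1 ≤ k)
    (c : (ι → ℕ) → ι) :
    ∃ (t : ι) (a b : ι → ℕ), IsIndex k a ∧ c a = t ∧ a t = 1 ∧ b t = k ∧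
      ReflTransGen (fun x y => IsIndex k y ∧ c y = t ∧ Close 2 x y) a b := by
  by_contra! hcon
  let Reach : ι → (ι → ℕ) → Prop := fun t i => ∃ a, IsIndex k a ∧ c a = t ∧ a t = 1 ∧
    ReflTransGen (fun x y => IsIndex k y ∧ c y = t ∧ Close 2 x y) a i
  have hReach : ∀ t i, Reach t i → IsIndex k i := by
    rintro t i ⟨a, ha, _, _, hai⟩
    cases hai with
    | refl => exact ha
    | tail _ h => exact h.1
  -- Vertices run over `0, …, k + 1`, one layer beyond the indices on each side, so that a reachable
  -- cube within `1` of the upper face must have coordinate `k`.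
  obtain ⟨x, hx, hcross⟩ := exists_cell_crossing (k + 1)
    (fun t => {x : ι → ℕ | x t = 0 ∨ ∃ i, Reach t i ∧ Close 1 x i})
    (fun t x _ hxt => Or.inl hxt) (by
      rintro t x _ hxt (h0 | ⟨i, hi, hxi⟩)
      · omega
      · obtain ⟨a, ha, hac, hat, hai⟩ := hi
        refine hcon t a i ha hac hat ?_ hai
        have h1 := (hReach t i ⟨a, ha, hac, hat, hai⟩ t).2
        have h2 := (hxi t).1
        omega)
  -- `v` is an index within distance `1` of every vertex of the crossing cell. For its own colour,
  -- the vertex `p` makes `v` reachable (two steps of size `1` give `Close 2`), whereas `q` says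
  -- that it is not.
  let v : ι → ℕ := fun s => max 1 (x s)
  have hv : IsIndex k v := fun s => by have := hx s; simp only [v]; omega
  obtain ⟨⟨p, hp, hpx⟩, q, hq, hqx⟩ := hcross (c v)
  by_cases hvR : Reach (c v) v
  · refine hq (Or.inr ⟨v, hvR, fun s => ?_⟩)
    have := hqx s
    simp only [v]; omega
  · rcases hp with hp | ⟨i, hi, hpi⟩
    · refine hvR ⟨v, hv, rfl, ?_, ReflTransGen.refl⟩
      have h1 := hpx (c v)
      have h2 : p (c v) = 0 := hp
      change max 1 (x (c v)) = 1
      omega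
    · obtain ⟨a, ha, hac, hat, hai⟩ := hi
      refine hvR ⟨a, ha, hac, hat, hai.tail ⟨hv, rfl, fun s => ?_⟩⟩
      have h1 := hpx s
      have h2 := hpi s
      have h3 := hReach (c v) i ⟨a, ha, hac, hat, hai⟩ s
      simp only [v]; omega

/-- `ℤᵈ` has asymptotic dimension at most `d`: it has a colouring by `d + 1` colours with
uniformly bounded monochromatic `L`-components; `l` is constant on these components. -/
theorem exists_coloring_bounded_components (d : ℕ) {L : ℤ} (hL : 0 < L) :
    ∃ (c : (Fin d → ℤ) → Fin (d + 1)) (l : (Fin d → ℤ) → Fin d → ℤ),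
      (∀ x y, c x = c y → (∀ s, |x s - y s| ≤ L) → l x = l y) ∧
      ∀ x y, c x = c y → l x = l y → ∀ s, |x s - y s| ≤ (d + 1) * L := by
  -- Pigeonhole: `d` coordinates block at most `d` of the `d + 1` residues. A colour `j` means that
  -- no coordinate lies in a slab of width `L` with number congruent to `j`. These slabs separate
  -- the components, which are numbered by `l`.
  have hex : ∀ x : Fin d → ℤ, ∃ j : Fin (d + 1), ∀ s, (x s / L) % ((d : ℤ) + 1) ≠ (j : ℕ) := by
    intro x
    by_contra! hcon
    choose s hs using hcon
    have hinj : Function.Injective s := fun i j hij => by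
      have h1 := hs i
      rw [hij, hs j] at h1
      exact Fin.ext (by exact_mod_cast h1.symm)
    have := Fintype.card_le_of_injective s hinj
    simp at this
  choose c hc using hex
  have hd : (0 : ℤ) < d + 1 := by positivity
  have hspec : ∀ x s, ∃ r : ℤ, 1 ≤ r ∧ L * ((d + 1) * ((x s - (c x : ℕ) * L) / L / (d + 1)) + r)
        ≤ x s - (c x : ℕ) * L ∧
      x s - (c x : ℕ) * L < L * ((d + 1) * ((x s - (c x : ℕ) * L) / L / (d + 1)) + (d + 1)) := by
    intro x s
    set u := x s - (c x : ℕ) * L with hu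
    have hq : u / L = x s / L - (c x : ℕ) := by
      rw [hu, Int.sub_mul_ediv_right _ _ hL.ne']
    have hne : (u / L) % ((d : ℤ) + 1) ≠ 0 := by
      intro h0
      apply hc x s
      have h1 : (x s / L) % ((d : ℤ) + 1) = ((c x : ℕ) : ℤ) % ((d : ℤ) + 1) := by
        rw [Int.emod_eq_emod_iff_emod_sub_eq_zero, ← hq, h0]
      rw [h1]
      refine Int.emod_eq_of_lt (by positivity) ?_
      have := (c x).2
      omega
    have h1 := Int.emod_nonneg (u / L) hd.ne'
    have h2 := Int.emod_lt_of_pos (u / L) hd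
    have h3 := Int.mul_ediv_add_emod (u / L) ((d : ℤ) + 1)
    have h4 := Int.mul_ediv_add_emod u L
    have h5 := Int.emod_nonneg u hL.ne'
    have h6 := Int.emod_lt_of_pos u hL
    refine ⟨(u / L) % ((d : ℤ) + 1), by omega, ?_, ?_⟩
    · rw [h3]; linarith
    · have h7 : u / L + 1 ≤ (d + 1) * (u / L / (d + 1)) + (d + 1) := by linarith
      have h8 := mul_le_mul_of_nonneg_left h7 hL.le
      linarith
  refine ⟨c, fun x s => (x s - (c x : ℕ) * L) / L / (d + 1), ?_, ?_⟩
  · have hle : ∀ x y, c x = c y → (∀ s, |x s - y s| ≤ L) → ∀ s,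
        (y s - (c y : ℕ) * L) / L / ((d : ℤ) + 1) ≤ (x s - (c x : ℕ) * L) / L / (d + 1) := by
      intro x y hxy hdist s
      by_contra! hlt
      obtain ⟨r, hr, h1, _⟩ := hspec y s
      obtain ⟨_, _, _, h2⟩ := hspec x s
      have h3 := (abs_le.1 (hdist s)).1
      rw [hxy] at h2 hlt
      set a := (x s - (c y : ℕ) * L) / L / ((d : ℤ) + 1)
      set b := (y s - (c y : ℕ) * L) / L / ((d : ℤ) + 1)
      have h4 : (d + 1) * a + (d + 1) ≤ ((d : ℤ) + 1) * b := by
        have := mul_le_mul_of_nonneg_left (Int.add_one_le_iff.2 hlt) hd.le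
        linarith
      have h5 := mul_le_mul_of_nonneg_left h4 hL.le
      have h6 := mul_le_mul_of_nonneg_left hr hL.le
      linarith
    intro x y hxy hdist
    ext s
    exact le_antisymm (hle y x hxy.symm (fun s => by rw [abs_sub_comm]; exact hdist s) s)
      (hle x y hxy hdist s)
  · intro x y hxy hl s
    have hls := congrFun hl s
    simp only at hls
    obtain ⟨r, hr, h1, h2⟩ := hspec x s
    obtain ⟨r', hr', h1', h2'⟩ := hspec y s
    rw [hxy] at h1 h2 hls
    rw [hls] at h1 h2
    have h6 := mul_le_mul_of_nonneg_left hr hL.le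
    have h7 := mul_le_mul_of_nonneg_left hr' hL.le
    rw [abs_le]
    constructor <;> linarith

/-- A Lipschitz map from the indices of the cubes to `ℤᵈ` has bounded image on some chain of
touching cubes joining opposite faces. -/
theorem exists_chain_bounded_image {d k : ℕ} (hk : 1 ≤ k) (G : (Fin (d + 1) → ℕ) → Fin d → ℤ)
    (hG : ∀ x y, IsIndex k x → IsIndex k y → ∀ r : ℕ, Close r x y →
      ∀ s, |G x s - G y s| ≤ (d + 1) * r) :
    ∃ (t : Fin (d + 1)) (a b : Fin (d + 1) → ℕ), IsIndex k a ∧ a t = 1 ∧ b t = k ∧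
      ReflTransGen (fun x y => (IsIndex k x ∧ ∀ s, |G x s - G a s| ≤ 2 * (d + 1) ^ 2 + (d + 1)) ∧
        (IsIndex k y ∧ ∀ s, |G y s - G a s| ≤ 2 * (d + 1) ^ 2 + (d + 1)) ∧ Close 1 x y) a b := by
  -- The scale `2(d + 1)` is the largest change of `G` over a `Close 2` step, so a monochromatic
  -- chain never leaves its component.
  obtain ⟨c, l, hcl, hbd⟩ := exists_coloring_bounded_components d
    (L := ((d : ℤ) + 1) * 2) (by positivity)
  obtain ⟨t, a, b, ha, hca, hat, hbt, hab⟩ := exists_monochromatic_chain hk fun x => c (G x)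
  refine ⟨t, a, b, ha, hat, hbt, ?_⟩
  clear hbt
  have hkey : IsIndex k b ∧ c (G b) = t ∧ l (G b) = l (G a) ∧
      ReflTransGen (fun x y => (IsIndex k x ∧ ∀ s, |G x s - G a s| ≤ 2 * (d + 1) ^ 2 + (d + 1)) ∧
        (IsIndex k y ∧ ∀ s, |G y s - G a s| ≤ 2 * (d + 1) ^ 2 + (d + 1)) ∧
          Close 1 x y) a b := by
    induction hab with
    | refl => exact ⟨ha, hca, rfl, ReflTransGen.refl⟩
    | @tail y z _ hyz ih =>
      obtain ⟨hy, hcy, hly, hay⟩ := ih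
      obtain ⟨hz, hcz, hcl2⟩ := hyz
      have hlz : l (G z) = l (G a) := by
        rw [← hly]
        exact hcl _ _ (hcz.trans hcy.symm) fun s => by simpa using hG z y hz hy 2 hcl2.symm s
      -- The midpoint restores actual contact of cubes. Its colour is not controlled, which costs
      -- the extra `d + 1` in the bound.
      let w : Fin (d + 1) → ℕ := fun s => (y s + z s) / 2
      have hw : IsIndex k w := fun s => by
        have := hy s; have := hz s; simp only [w]; omega
      have hyw : Close 1 y w := fun s => by have := hcl2 s; simp only [w]; omega
      have hwz : Close 1 w z := fun s => by have := hcl2 s; simp only [w]; omega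
      have hby := hbd _ _ (hcy.trans hca.symm) hly
      have hbz := hbd _ _ (hcz.trans hca.symm) hlz
      have hd : (0 : ℤ) ≤ d + 1 := by positivity
      have hby' : ∀ s, |G y s - G a s| ≤ 2 * (d + 1) ^ 2 + (d + 1) := fun s => by
        have := hby s; linarith
      have hbz' : ∀ s, |G z s - G a s| ≤ 2 * (d + 1) ^ 2 + (d + 1) := fun s => by
        have := hbz s; linarith
      have hbw' : ∀ s, |G w s - G a s| ≤ 2 * (d + 1) ^ 2 + (d + 1) := fun s => by
        have h1 := hG w y hw hy 1 hyw.symm s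
        have h2 := abs_sub_le (G w s) (G y s) (G a s)
        have h3 := hby s
        push_cast at h1
        linarith
      exact ⟨hz, hcz, hlz, (hay.tail ⟨⟨hy, hby'⟩, ⟨hw, hbw'⟩, hyw⟩).tail
        ⟨⟨hw, hbw'⟩, ⟨hz, hbz'⟩, hwz⟩⟩
  exact hkey.2.2.2

theorem isCompact_box (n k : ℕ) (i : Fin n → ℕ) : IsCompact (box n k i) :=
  isCompact_univ_pi fun _ => isCompact_Icc

theorem isConnected_box (n k : ℕ) (i : Fin n → ℕ) : IsConnected (box n k i) := by
  refine ⟨⟨fun s => (i s : ℝ) / k, fun s _ => ⟨?_, le_rfl⟩⟩,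
    (convex_pi fun s _ => convex_Icc _ _).isPreconnected⟩
  beta_reduce
  gcongr
  linarith

theorem box_inter_nonempty {n : ℕ} (k : ℕ) {i j : Fin n → ℕ} (h : Close 1 i j) :
    (box n k i ∩ box n k j).Nonempty := by
  refine ⟨fun s => ((min (i s) (j s) : ℕ) : ℝ) / k, fun s _ => ⟨?_, ?_⟩, fun s _ => ⟨?_, ?_⟩⟩
  all_goals
    have h1 : (i s : ℝ) ≤ j s + 1 := by exact_mod_cast (h s).1
    have h2 : (j s : ℝ) ≤ i s + 1 := by exact_mod_cast (h s).2
    beta_reduce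
    rw [Nat.cast_min]
    gcongr
  · exact le_min (by linarith) (by linarith)
  · exact min_le_left _ _
  · exact le_min (by linarith) (by linarith)
  · exact min_le_right _ _

theorem box_subset_unitCube {n k : ℕ} {i : Fin n → ℕ} (hi : IsIndex k i) :
    box n k i ⊆ unitCube n := by
  intro z hz s _
  have h1 := hz s trivial
  have h2 : (1 : ℝ) ≤ i s := by exact_mod_cast (hi s).1
  have h3 : (i s : ℝ) ≤ k := by exact_mod_cast (hi s).2
  exact ⟨le_trans (div_nonneg (by linarith) (by positivity)) h1.1,
    h1.2.trans (div_le_one_of_le₀ h3 (by positivity))⟩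

/-- Cubes sharing a facet have an intersection of dimension at least `d = n - 1`. -/
theorem le_topDim_box_inter {d k : ℕ} (hk : 1 ≤ k) (i : Fin (d + 1) → ℕ) (t : Fin (d + 1)) :
    (d : WithBot ℕ∞) ≤ topDim (box (d + 1) k i ∩ box (d + 1) k (i + Pi.single t 1)) := by
  have hk0 : (0 : ℝ) < k := by exact_mod_cast hk
  refine le_topDim_of_face_subset ((isCompact_box _ _ _).inter (isCompact_box _ _ _)) t
    ((i t : ℝ) / k) (fun s => ((i s : ℝ) - 1) / k) (w := 1 / k) (by positivity) ?_
  intro x hxt hx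
  refine ⟨fun s _ => ?_, fun s _ => ?_⟩ <;> by_cases hs : s = t
  · subst hs
    rw [hxt]
    exact ⟨by gcongr; linarith, le_rfl⟩
  · have h := hx s hs
    rw [← add_div, sub_add_cancel] at h
    exact h
  · subst hs
    rw [hxt]
    simp only [Pi.add_apply, Pi.single_eq_same]
    push_cast
    exact ⟨by gcongr; linarith, by gcongr; linarith⟩
  · have h := hx s hs
    rw [← add_div, sub_add_cancel] at h
    simpa [hs] using h

/-- A staircase path moving one coordinate at a time stays in the grid and has the `ℓ¹`-distance as
its length. Only facet-sharing neighbours are used, so this applies up to `m = n - 1`. -/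
theorem norm_sub_le_sum_of_unit_steps {n k : ℕ} {E : Type*} [SeminormedAddCommGroup E]
    (G : (Fin n → ℕ) → E)
    (hG : ∀ i t, IsIndex k i → IsIndex k (i + Pi.single t 1) →
      ‖G i - G (i + Pi.single t 1)‖ ≤ 1)
    {i j : Fin n → ℕ} (hi : IsIndex k i) (hj : IsIndex k j) :
    ‖G i - G j‖ ≤ ((∑ s, ((i s - j s) + (j s - i s)) : ℕ) : ℝ) := by
  obtain ⟨D, hD⟩ : ∃ D, D = ∑ s, ((i s - j s) + (j s - i s)) := ⟨_, rfl⟩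
  rw [← hD]
  induction D generalizing i j with
  | zero =>
    have : i = j := by
      ext s
      have := (Finset.sum_eq_zero_iff.1 hD.symm) s (mem_univ s)
      omega
    simp [this]
  | succ D ih =>
    have hmove : ∀ i j : Fin n → ℕ, IsIndex k i → IsIndex k j →
        D + 1 = ∑ s, ((i s - j s) + (j s - i s)) → ∀ t, i t < j t → ‖G i - G j‖ ≤ D + 1 := by
      intro i j hi hj hD t ht
      have hi' : IsIndex k (i + Pi.single t 1) := by
        intro s
        by_cases hs : s = t
        · subst hs
          have := hi s; have := hj s
          simp; omega
        · simpa [hs] using hi s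
      have hDD : D = ∑ s, (((i + Pi.single t 1 : Fin n → ℕ) s - j s) +
          (j s - (i + Pi.single t 1 : Fin n → ℕ) s)) := by
        rw [← Finset.add_sum_erase _ _ (mem_univ t)] at hD ⊢
        rw [Finset.sum_congr rfl fun s hs => by
          rw [Pi.add_apply, Pi.single_eq_of_ne (ne_of_mem_erase hs), add_zero]]
        simp only [Pi.add_apply, Pi.single_eq_same]
        omega
      have h1 := hG i t hi hi'
      have h2 := ih hi' hj hDD
      linarith [norm_sub_le_norm_sub_add_norm_sub (G i) (G (i + Pi.single t 1)) (G j)]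
    push_cast
    obtain ⟨t, ht⟩ : ∃ t, i t ≠ j t := by
      by_contra! h
      simp [h] at hD
    rcases lt_or_gt_of_ne ht with ht | ht
    · exact hmove i j hi hj hD t ht
    · rw [norm_sub_rev]
      exact hmove j i hj hi (by simpa only [add_comm (j _ - i _)] using hD) t ht

theorem isRConnected_Icc {d : ℕ} (lo hi : Fin d → ℤ) :
    IsRConnected 1 ((Finset.Icc lo hi : Finset (Fin d → ℤ)) : Set (Fin d → ℤ)) := by
  intro x hx y hy
  simp only [Finset.coe_Icc, Set.mem_Icc, Pi.le_def] at hx hy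
  obtain ⟨N, hN⟩ : ∃ N : ℕ, ∀ s, |y s - x s| ≤ N := by
    refine ⟨∑ s, (y s - x s).natAbs, fun s => ?_⟩
    rw [Int.abs_eq_natAbs]
    exact_mod_cast Finset.single_le_sum (f := fun s => (y s - x s).natAbs)
      (fun _ _ => Nat.zero_le _) (mem_univ s)
  -- Each coordinate moves towards its target at unit speed and then rests.
  refine ⟨N, fun j s => max (x s - (j : ℕ)) (min (x s + (j : ℕ)) (y s)), fun j => ?_,
    fun j => ?_, ?_, ?_⟩
  · simp only [Finset.coe_Icc, Set.mem_Icc, Pi.le_def]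
    constructor <;> intro s <;> have := hx.1 s <;> have := hx.2 s <;> have := hy.1 s <;>
      have := hy.2 s <;> omega
  · refine (dist_pi_le_iff zero_le_one).2 fun s => ?_
    rw [Int.dist_eq']
    simp only [Fin.val_castSucc, Fin.val_succ]
    have : |max (x s - (j : ℕ)) (min (x s + (j : ℕ)) (y s)) -
        max (x s - ((j : ℕ) + 1 : ℕ)) (min (x s + ((j : ℕ) + 1 : ℕ)) (y s))| ≤ 1 := by
      rw [abs_le]; push_cast; omega
    exact_mod_cast this
  · ext s
    simp
  · ext s
    have := abs_le.1 (hN s)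
    simp only [Fin.val_last]
    omega

/-- An upper bound for the optimal constant. -/
theorem hasLevelProperty_of_le {d m : ℕ} (hm : m ≤ d) :
    HasLevelProperty (d + 1) m ((2 * (2 * (d + 1) ^ 2 + (d + 1)) + 1) ^ d) := by
  classical
  intro k hk F hF
  let G : (Fin (d + 1) → ℕ) → Fin d → ℤ := fun i =>
    if h : IsIndex k i then F ⟨box (d + 1) k i, i, h, rfl⟩ else 0
  have hGF : ∀ i (h : IsIndex k i), G i = F ⟨box (d + 1) k i, i, h, rfl⟩ := fun i h => dif_pos h
  have hstep : ∀ i t, IsIndex k i → IsIndex k (i + Pi.single t 1) →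
      ‖G i - G (i + Pi.single t 1)‖ ≤ 1 := by
    intro i t hi hi'
    rw [hGF i hi, hGF _ hi']
    exact hF _ _ (le_trans (by exact_mod_cast hm) (le_topDim_box_inter hk i t))
  have hlip : ∀ x y, IsIndex k x → IsIndex k y → ∀ r : ℕ, Close r x y →
      ∀ s, |G x s - G y s| ≤ (d + 1) * r := by
    intro x y hx hy r hr s
    have h1 := (norm_le_pi_norm (G x - G y) s).trans (norm_sub_le_sum_of_unit_steps G hstep hx hy)
    rw [Pi.sub_apply, Int.norm_eq_abs] at h1
    have h2 : ∑ s, ((x s - y s) + (y s - x s)) ≤ (d + 1) * r := by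
      refine (Finset.sum_le_card_nsmul univ _ r fun s _ => ?_).trans (by simp)
      have := hr s
      omega
    have h3 : (|G x s - G y s| : ℤ) ≤ ((∑ s, ((x s - y s) + (y s - x s)) : ℕ) : ℤ) := by
      exact_mod_cast h1
    exact h3.trans (by exact_mod_cast h2)
  obtain ⟨t, a, b, ha, hat, hbt, hab⟩ := exists_chain_bounded_image hk G hlip
  set M : ℤ := 2 * (d + 1) ^ 2 + (d + 1) with hM
  have hM0 : 0 ≤ M := by positivity
  set E : (Fin (d + 1) → ℕ) → (Fin (d + 1) → ℕ) → Prop := fun x y =>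
    (IsIndex k x ∧ ∀ s, |G x s - G a s| ≤ M) ∧ (IsIndex k y ∧ ∀ s, |G y s - G a s| ≤ M) ∧
      Close 1 x y with hE
  have hreach : ∀ i, ReflTransGen E a i → IsIndex k i ∧ ∀ s, |G i s - G a s| ≤ M := by
    intro i hi
    cases hi with
    | refl => exact ⟨ha, fun s => by simpa using hM0⟩
    | tail _ h => exact h.2.1
  let T : Set (Fin (d + 1) → ℕ) := {i | ReflTransGen E a i}
  let S : Set (cubes (d + 1) k) := {K | ∃ i, ∃ h : ReflTransGen E a i,
    K = ⟨box (d + 1) k i, i, (hreach i h).1, rfl⟩}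
  have hU : unionOf S = ⋃ i ∈ T, box (d + 1) k i := by
    ext z
    simp only [unionOf, Set.mem_iUnion]
    constructor
    · rintro ⟨_, ⟨i, hi, rfl⟩, hz⟩
      exact ⟨i, hi, hz⟩
    · rintro ⟨i, hi, hz⟩
      exact ⟨_, ⟨i, hi, rfl⟩, hz⟩
  refine ⟨Finset.Icc (fun s => G a s - M) (fun s => G a s + M), isRConnected_Icc _ _, ?_, S, ?_,
    t, ?_, ?_, ?_, ?_⟩
  · have hcard : (Finset.Icc (fun s => G a s - M) (fun s => G a s + M)).card =
        (2 * M + 1).toNat ^ d := by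
      rw [Pi.card_Icc]
      have : ∀ s, (G a s + M + 1 - (G a s - M)).toNat = (2 * M + 1).toNat := fun s => by
        congr 1; ring
      simp [this]
    refine le_of_eq ((congrArg (Nat.cast : ℕ → ℝ) hcard).trans ?_)
    have h1 : (((2 * M + 1).toNat : ℤ) : ℝ) = 2 * (2 * (d + 1) ^ 2 + (d + 1)) + 1 := by
      rw [Int.toNat_of_nonneg (by positivity), hM]
      push_cast
      ring
    rw [Nat.cast_pow, ← h1, Int.cast_natCast]
  · rintro _ ⟨i, hi, rfl⟩
    have h := hreach i hi
    rw [Set.mem_preimage, ← hGF i h.1]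
    refine Finset.mem_coe.2 (Finset.mem_Icc.2 ⟨fun s => ?_, fun s => ?_⟩) <;>
    · have := abs_le.1 (h.2 s)
      linarith [this.1, this.2]
  · rw [hU]
    exact Set.iUnion₂_subset fun i hi => box_subset_unitCube (hreach i hi).1
  · rw [hU]
    refine IsConnected.biUnion_of_reflTransGen ⟨a, ReflTransGen.refl⟩
      (fun i _ => isConnected_box _ _ i) fun i hi j hj => ?_
    let Q : (Fin (d + 1) → ℕ) → (Fin (d + 1) → ℕ) → Prop := fun i j =>
      (box (d + 1) k i ∩ box (d + 1) k j).Nonempty ∧ i ∈ T ∧ j ∈ T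
    have hQ : ∀ j, ReflTransGen E a j → ReflTransGen Q a j := by
      intro j hj
      induction hj with
      | refl => exact ReflTransGen.refl
      | tail hx hxy ih =>
        exact ih.tail ⟨box_inter_nonempty k hxy.2.2, hx, hx.tail hxy⟩
    have hsymm : Std.Symm Q := ⟨fun i j h => ⟨Set.inter_comm _ _ ▸ h.1, h.2.2, h.2.1⟩⟩
    exact ReflTransGen.mono (fun x y h => ⟨h.1, h.2.1⟩) _ _
      ((ReflTransGen.stdSymm.symm _ _ (hQ i hi)).trans (hQ j hj))
  · refine ⟨fun s => ((a s : ℝ) - 1) / k, ?_, ?_, by simp [hat]⟩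
    · rw [hU]
      refine Set.mem_biUnion (show a ∈ T from ReflTransGen.refl) fun s _ => ⟨le_rfl, ?_⟩
      gcongr; linarith
    · refine box_subset_unitCube ha fun s _ => ⟨le_rfl, ?_⟩
      gcongr; linarith
  · have hk0 : (k : ℝ) ≠ 0 := by positivity
    have hmem : (fun s => (b s : ℝ) / k) ∈ box (d + 1) k b := fun s _ =>
      ⟨by beta_reduce; gcongr; linarith, le_rfl⟩
    refine ⟨fun s => (b s : ℝ) / k, ?_, box_subset_unitCube (hreach b hab).1 hmem, ?_⟩
    · rw [hU]
      exact Set.mem_biUnion (show b ∈ T from hab) hmem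
    · simp only [hbt]
      exact div_self hk0

end UpperBound

/-! ### A single level does not suffice: a colouring with side `k = 3`. -/

section LowerBound

/-- The index of a cube. -/
noncomputable def cubeIndex {n k : ℕ} (K : cubes n k) : Fin n → ℕ := K.2.choose

theorem isIndex_cubeIndex {n k : ℕ} (K : cubes n k) : IsIndex k (cubeIndex K) :=
  K.2.choose_spec.1

theorem coe_eq_box_cubeIndex {n k : ℕ} (K : cubes n k) :
    (K : Set (Fin n → ℝ)) = box n k (cubeIndex K) := K.2.choose_spec.2

theorem finite_cubes (n k : ℕ) : (cubes n k).Finite := by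
  refine ((Fintype.piFinset fun _ : Fin n => Finset.Icc 1 k).finite_toSet.image
    (box n k)).subset ?_
  rintro _ ⟨i, hi, rfl⟩
  exact ⟨i, Finset.mem_coe.2 (Fintype.mem_piFinset.2 fun s => Finset.mem_Icc.2 (hi s)), rfl⟩

theorem close_of_box_inter_nonempty {n k : ℕ} (hk : 1 ≤ k) {i j : Fin n → ℕ}
    (h : (box n k i ∩ box n k j).Nonempty) : Close 1 i j := by
  obtain ⟨z, hi, hj⟩ := h
  have hk0 : (0 : ℝ) < k := by exact_mod_cast hk
  intro s
  have h1 := (hi s trivial).1.trans (hj s trivial).2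
  have h2 := (hj s trivial).1.trans (hi s trivial).2
  rw [div_le_div_iff_of_pos_right hk0, sub_le_iff_le_add] at h1 h2
  exact ⟨by exact_mod_cast h1, by exact_mod_cast h2⟩

/-- If the monochromatic components of a colouring of the cubes do not touch opposite faces, then
no monochromatic family of cubes connects some opposite faces. -/
theorem not_connectsSomeFaces_of_components {n k : ℕ} (hk : 1 ≤ k) {α β : Type*}
    (c : (Fin n → ℕ) → α) (l : (Fin n → ℕ) → β)
    (hl : ∀ i j, IsIndex k i → IsIndex k j → Close 1 i j → c i = c j → l i = l j)
    (hspan : ∀ i j, IsIndex k i → IsIndex k j → c i = c j → l i = l j →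
      ∀ s, i s = 1 → j s ≠ k)
    (p : α) (S : Set (cubes n k)) (hS : ∀ K ∈ S, c (cubeIndex K) = p) :
    ¬ ConnectsSomeFaces (unionOf S) := by
  rintro ⟨s, -, hconn, ⟨z, hz, -, hz0⟩, ⟨w, hw, -, hw1⟩⟩
  have hk0 : (0 : ℝ) < k := by exact_mod_cast hk
  have hfin := finite_cubes n k
  have : Finite (cubes n k) := hfin
  obtain ⟨K, hK, hzK⟩ := Set.mem_iUnion₂.1 hz
  obtain ⟨K', hK', hwK⟩ := Set.mem_iUnion₂.1 hw
  have hclosed : ∀ T : Set (cubes n k), IsClosed (unionOf T) := fun T =>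
    T.toFinite.isClosed_biUnion fun L _ => by
      rw [coe_eq_box_cubeIndex]
      exact (isCompact_box _ _ _).isClosed
  have hi : cubeIndex K s = 1 := by
    rw [coe_eq_box_cubeIndex] at hzK
    have h1 := (hzK s trivial).1
    rw [hz0, div_le_iff₀ hk0, zero_mul, sub_nonpos] at h1
    have h2 : cubeIndex K s ≤ 1 := by exact_mod_cast h1
    have h3 := (isIndex_cubeIndex K s).1
    omega
  have hj : cubeIndex K' s = k := by
    rw [coe_eq_box_cubeIndex] at hwK
    have h1 := (hwK s trivial).2
    rw [hw1, le_div_iff₀ hk0, one_mul] at h1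
    have h2 : k ≤ cubeIndex K' s := by exact_mod_cast h1
    have h3 := (isIndex_cubeIndex K' s).2
    omega
  have hne : l (cubeIndex K) ≠ l (cubeIndex K') := fun h =>
    hspan _ _ (isIndex_cubeIndex K) (isIndex_cubeIndex K') ((hS K hK).trans (hS K' hK').symm) h s
      hi hj
  -- The cubes labelled like `K` and the other cubes of `S` have closed unions covering a connected
  -- set, so two of them with different labels touch, against `hl`.
  obtain ⟨y, _, hyA, hyB⟩ := isPreconnected_closed_iff.1 hconn.isPreconnected
    (unionOf {L ∈ S | l (cubeIndex L) = l (cubeIndex K)})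
    (unionOf {L ∈ S | l (cubeIndex L) ≠ l (cubeIndex K)}) (hclosed _) (hclosed _)
    (fun y hy => by
      obtain ⟨L, hL, hyL⟩ := Set.mem_iUnion₂.1 hy
      by_cases h : l (cubeIndex L) = l (cubeIndex K)
      · exact Or.inl (Set.mem_biUnion (show L ∈ {L ∈ S | _} from ⟨hL, h⟩) hyL)
      · exact Or.inr (Set.mem_biUnion (show L ∈ {L ∈ S | _} from ⟨hL, h⟩) hyL))
    ⟨z, hz, Set.mem_biUnion (show K ∈ {L ∈ S | _} from ⟨hK, rfl⟩) hzK⟩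
    ⟨w, hw, Set.mem_biUnion (show K' ∈ {L ∈ S | _} from ⟨hK', hne.symm⟩) hwK⟩
  obtain ⟨L, hL, hyL⟩ := Set.mem_iUnion₂.1 hyA
  obtain ⟨L', hL', hyL'⟩ := Set.mem_iUnion₂.1 hyB
  rw [coe_eq_box_cubeIndex] at hyL hyL'
  exact hL'.2 ((hl _ _ (isIndex_cubeIndex L') (isIndex_cubeIndex L)
    (close_of_box_inter_nonempty hk ⟨y, hyL', hyL⟩)
    ((hS L' hL'.1).trans (hS L hL.1).symm)).trans hL.2)

/-- Even `m = 0` excludes the empty intersection, whose dimension is `⊥`. Hence a map that is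
Lipschitz over all touching cubes is admissible for every `m`. -/
theorem close_cubeIndex_of_le_topDim {n k m : ℕ} (hk : 1 ≤ k) {K L : cubes n k}
    (h : (m : WithBot ℕ∞) ≤ topDim ((K : Set (Fin n → ℝ)) ∩ (L : Set (Fin n → ℝ)))) :
    Close 1 (cubeIndex K) (cubeIndex L) := by
  refine close_of_box_inter_nonempty hk ?_
  rw [← coe_eq_box_cubeIndex, ← coe_eq_box_cubeIndex]
  by_contra hne
  have : IsEmpty ↥((K : Set (Fin n → ℝ)) ∩ (L : Set (Fin n → ℝ))) :=
    Set.isEmpty_coe_sort.2 (Set.not_nonempty_iff_eq_empty.1 hne)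
  rw [topDim, smallInductiveDimension_of_isEmpty, le_bot_iff] at h
  exact WithBot.coe_ne_bot h

/-- The monochromatic components of a colouring of the `27` cubes of `cubes 3 3` by the points of
`{0, 1}²`. -/
def piece : Fin 3 → Fin 3 → Fin 3 → Fin 8 :=
  ![![![0, 3, 3], ![0, 3, 3], ![7, 7, 1]],
    ![![0, 6, 6], ![5, 5, 1], ![7, 7, 1]],
    ![![5, 5, 6], ![5, 5, 4], ![2, 4, 4]]]

/-- The first coordinate of the colour of a component. -/
def pieceFst : Fin 8 → ℕ := ![0, 0, 0, 1, 1, 0, 1, 1]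

/-- The second coordinate of the colour of a component. -/
def pieceSnd : Fin 8 → ℕ := ![0, 0, 0, 0, 0, 1, 1, 1]

theorem pieceFst_le : ∀ q, pieceFst q ≤ 1 := by decide

theorem pieceSnd_le : ∀ q, pieceSnd q ≤ 1 := by decide

/-- Different pieces of the same colour do not touch, even at a corner: a finite check. -/
theorem piece_eq_of_close : ∀ a a' : Fin 3, (a : ℕ) ≤ a' + 1 → (a' : ℕ) ≤ a + 1 →
    ∀ b b' : Fin 3, (b : ℕ) ≤ b' + 1 → (b' : ℕ) ≤ b + 1 →
    ∀ c c' : Fin 3, (c : ℕ) ≤ c' + 1 → (c' : ℕ) ≤ c + 1 →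
      pieceFst (piece a b c) = pieceFst (piece a' b' c') →
      pieceSnd (piece a b c) = pieceSnd (piece a' b' c') → piece a b c = piece a' b' c' := by
  decide +kernel

theorem piece_not_spanning : ∀ a b c a' b' c' : Fin 3, piece a b c = piece a' b' c' →
    ¬ (a = 0 ∧ a' = 2) ∧ ¬ (b = 0 ∧ b' = 2) ∧ ¬ (c = 0 ∧ c' = 2) := by
  decide +kernel

/-- The component of the projection of a cube to the first three coordinates. -/
def pieceOf {d : ℕ} (x : Fin (d + 3) → ℕ) : Fin 8 :=
  piece (Fin.ofNat 3 (x 0 - 1)) (Fin.ofNat 3 (x 1 - 1)) (Fin.ofNat 3 (x 2 - 1))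

/-- A colouring of the indices of `cubes (d + 3) 3` without large monochromatic components. -/
def levelColoring {d : ℕ} (x : Fin (d + 3) → ℕ) : Fin (d + 2) → ℤ :=
  Fin.cons (pieceFst (pieceOf x) : ℤ)
    (Fin.cons (pieceSnd (pieceOf x) : ℤ) fun s : Fin d => (x s.succ.succ.succ : ℤ))

theorem levelColoring_eq_iff {d : ℕ} {x y : Fin (d + 3) → ℕ} :
    levelColoring x = levelColoring y ↔ pieceFst (pieceOf x) = pieceFst (pieceOf y) ∧
      pieceSnd (pieceOf x) = pieceSnd (pieceOf y) ∧
        ∀ s : Fin d, x s.succ.succ.succ = y s.succ.succ.succ := by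
  rw [levelColoring, levelColoring, Fin.cons_inj, Fin.cons_inj, Nat.cast_inj, Nat.cast_inj,
    funext_iff]
  simp only [Nat.cast_inj]

theorem norm_levelColoring_sub_le {d : ℕ} {x y : Fin (d + 3) → ℕ} (h : Close 1 x y) :
    ‖levelColoring x - levelColoring y‖ ≤ 1 := by
  have hcoord : ∀ a b : ℕ, a ≤ b + 1 → b ≤ a + 1 → ‖(a : ℤ) - b‖ ≤ 1 := by
    intro a b h1 h2
    have : |(a : ℤ) - b| ≤ 1 := by rw [abs_le]; omega
    rw [Int.norm_eq_abs]
    exact_mod_cast this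
  refine (pi_norm_le_iff_of_nonneg zero_le_one).2 fun s => ?_
  rw [Pi.sub_apply, levelColoring, levelColoring]
  have h1 := pieceFst_le (pieceOf x)
  have h2 := pieceFst_le (pieceOf y)
  have h3 := pieceSnd_le (pieceOf x)
  have h4 := pieceSnd_le (pieceOf y)
  refine Fin.cases ?_ (fun s => Fin.cases ?_ (fun s => ?_) s) s
  · exact hcoord _ _ (by omega) (by omega)
  · exact hcoord _ _ (by omega) (by omega)
  · exact hcoord _ _ (h _).1 (h _).2

theorem val_ofNat_sub_one {d : ℕ} {x : Fin (d + 3) → ℕ} (hx : IsIndex 3 x) (s : Fin (d + 3)) :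
    (Fin.ofNat 3 (x s - 1) : ℕ) = x s - 1 := by
  have := hx s
  exact Nat.mod_eq_of_lt (by omega)

theorem pieceOf_eq_of_close {d : ℕ} {x y : Fin (d + 3) → ℕ} (hx : IsIndex 3 x)
    (hy : IsIndex 3 y) (h : Close 1 x y) (hc : levelColoring x = levelColoring y) :
    pieceOf x = pieceOf y := by
  obtain ⟨h1, h2, -⟩ := levelColoring_eq_iff.1 hc
  have hle : ∀ s, (Fin.ofNat 3 (x s - 1) : ℕ) ≤ (Fin.ofNat 3 (y s - 1) : ℕ) + 1 ∧
      (Fin.ofNat 3 (y s - 1) : ℕ) ≤ (Fin.ofNat 3 (x s - 1) : ℕ) + 1 := fun s => by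
    rw [val_ofNat_sub_one hx, val_ofNat_sub_one hy]
    have := h s
    omega
  exact piece_eq_of_close _ _ (hle 0).1 (hle 0).2 _ _ (hle 1).1 (hle 1).2 _ _ (hle 2).1 (hle 2).2
    h1 h2

theorem pieceOf_not_spanning {d : ℕ} {x y : Fin (d + 3) → ℕ}
    (hc : levelColoring x = levelColoring y) (hp : pieceOf x = pieceOf y) (s : Fin (d + 3))
    (hxs : x s = 1) : y s ≠ 3 := by
  intro hys
  have h := piece_not_spanning _ _ _ _ _ _ hp
  have h0 : ∀ t, x t = 1 → y t = 3 →
      Fin.ofNat 3 (x t - 1) = 0 ∧ Fin.ofNat 3 (y t - 1) = 2 := fun t h1 h2 => by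
    rw [h1, h2]; exact ⟨rfl, rfl⟩
  revert hxs hys
  refine Fin.cases (fun h1 h2 => h.1 (h0 _ h1 h2)) (fun s => ?_) s
  refine Fin.cases (fun h1 h2 => h.2.1 (h0 _ h1 h2)) (fun s => ?_) s
  -- From the fourth coordinate on, the colour records the coordinate itself, so it cannot be both
  -- `1` and `3`.
  refine Fin.cases (fun h1 h2 => h.2.2 (h0 _ h1 h2)) (fun s h1 h2 => ?_) s
  have := (levelColoring_eq_iff.1 hc).2.2 s
  omega

/-- A single level value does not suffice. -/
theorem exists_admissible_levels_not_connecting (d m : ℕ) :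
    ∃ F : cubes (d + 3) 3 → (Fin (d + 2) → ℤ), IsAdmissible m F ∧
      ∀ (p : Fin (d + 2) → ℤ) (S : Set (cubes (d + 3) 3)), S ⊆ F ⁻¹' {p} →
        ¬ ConnectsSomeFaces (unionOf S) :=
  ⟨fun K => levelColoring (cubeIndex K),
    fun _ _ h => norm_levelColoring_sub_le (close_cubeIndex_of_le_topDim (by norm_num) h),
    fun p S hS => not_connectsSomeFaces_of_components (by norm_num) levelColoring pieceOf
      (fun _ _ hx hy h hc => pieceOf_eq_of_close hx hy h hc)
      (fun _ _ _ _ hc hp s => pieceOf_not_spanning hc hp s) p S fun _ hK => hS hK⟩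

end LowerBound

/-! ### Integrality of the constants and attainment of the minimum. -/

theorem two_le_of_hasLevelProperty {d m : ℕ} {C : ℝ} (hC : HasLevelProperty (d + 3) m C) :
    2 ≤ C := by
  by_contra! hlt
  obtain ⟨F, hF, hno⟩ := exists_admissible_levels_not_connecting d m
  obtain ⟨P, -, hcard, S, hS, hconn⟩ := hC 3 (by norm_num) F hF
  have h1 : P.card < 2 := by exact_mod_cast hcard.trans_lt hlt
  obtain ⟨p, hp⟩ := Finset.card_le_one_iff_subset_singleton.1 (Nat.lt_succ_iff.1 h1)
  exact hno p S (fun K hK => by simpa using hp (hS hK)) hconn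

theorem HasLevelProperty.natFloor {n m : ℕ} {C : ℝ} (hC : HasLevelProperty n m C) :
    HasLevelProperty n m (⌊C⌋₊ : ℝ) := fun k hk F hF =>
  let ⟨P, hP, hcard, h⟩ := hC k hk F hF
  ⟨P, hP, by exact_mod_cast Nat.le_floor hcard, h⟩

theorem exists_isLeast_levelConstants {d m : ℕ} (hm : m ≤ d + 2) :
    ∃ C, IsLeast (levelConstants (d + 3) m) C := by
  classical
  have hmem : ∀ C, HasLevelProperty (d + 3) m C → ∃ N : ℕ, HasLevelProperty (d + 3) m N :=
    fun C hC => ⟨_, hC.natFloor⟩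
  have hex := hmem _ (hasLevelProperty_of_le hm)
  refine ⟨(Nat.find hex : ℝ), ⟨?_, Nat.find_spec hex⟩, fun C hC => ?_⟩
  · linarith [two_le_of_hasLevelProperty (Nat.find_spec hex)]
  · exact le_trans (by exact_mod_cast Nat.find_min' hex hC.2.natFloor) (Nat.floor_le hC.1.le)

end Chessboard

/-- The first conjunct says that the optimal constant really is the minimum of the admissible
constants; the last one spells out that a single level value does not suffice. -/
theorem mainTheorem6 (n m : ℕ) (hn : 3 ≤ n) (hm : m ≤ n - 1) :
    IsLeast (Chessboard.levelConstants n m) (Chessboard.optimalConstant n m) ∧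
    1 < Chessboard.optimalConstant n m ∧
    ∃ k : ℕ, 1 ≤ k ∧ ∃ F : Chessboard.cubes n k → (Fin (n - 1) → ℤ),
      Chessboard.IsAdmissible m F ∧
      ∀ (p : Fin (n - 1) → ℤ) (S : Set (Chessboard.cubes n k)), S ⊆ F ⁻¹' {p} →
        ¬ Chessboard.ConnectsSomeFaces (Chessboard.unionOf S) := by
  obtain ⟨d, rfl⟩ := Nat.exists_eq_add_of_le' hn
  obtain ⟨C, hC⟩ := Chessboard.exists_isLeast_levelConstants (d := d) (m := m) hm
  have hopt : Chessboard.optimalConstant (d + 3) m = C := hC.csInf_eq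
  rw [hopt]
  refine ⟨hC, ?_, 3, by norm_num, Chessboard.exists_admissible_levels_not_connecting d m⟩
  linarith [Chessboard.two_le_of_hasLevelProperty hC.1.2]
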